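/- Let $K$ be a field complete with respect to a non-trivial discrete valuation $v\colon K\to\mathbb R\cup\{+\infty\}$, with valuation ring $R$ and uniformizer $\pi$ (a generator of the maximal ideal of $R$). Let $n,r\ge 0$ be integers and let $\mathcal R=R\langle x_1,\dots,x_n,y_1,\dots,y_r\rangle$ be the ring of power series with coefficients in $R$ whose coefficients tend to $0$ (that is, for every real $C$ all but finitely many coefficients have valuation $>C$). An ideal $J\subseteq\mathcal R$ is called saturated if $J=J^{\mathrm{ec}}:=\{f\in\mathcal R : af\in J\text{ for some } a\in R\setminus\{0\}\}$. Fix a monomial order $<_\omega$ on the monomials in the $x_i,y_j$ (a well-order compatible with multiplication). Order terms ($a,a'\in R\setminus\{0\}$; $m,m'$ monomials) by $am<a'm'$ if $v(a)>v(a')$, or $v(a)=v(a')$ and $m<_\omega m'$. Every nonzero $f\in\mathcal R$ has a largest term, its leading term $\mathrm{LT}(f)$. A Gröbner basis of an ideal $J$ is a finite subset $G\subseteq J$ such that for each nonzero $f\in J$ the term $\mathrm{LT}(f)$ is a multiple in $\mathcal R$ of $\mathrm{LT}(g)$ for some nonzero $g\in G$. It is reduced if for every $g\in G$: $\mathrm{LT}(g)$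 has coefficient $1$; no term of $g$ is a multiple of $\mathrm{LT}(h)$ for any $h\in G\setminus\{g\}$; and no term of $g-\mathrm{LT}(g)$ is a multiple of $\mathrm{LT}(g)$. Proposition. Let $J$ be a saturated ideal of $\mathcal R$ and let $M$ be a positive integer. Then $J$ has exactly one reduced Gröbner basis $G$ with respect to $<_\omega$, and the following are equivalent: (a) $J$ admits a set of generators such that the reduction modulo $\pi^M$ of each generator does not involve any of the variables $y_1,\dots,y_r$; (b) the reduction modulo $\pi^M$ of each element of $G$ does not involve any of the variables $y_1,\dots,y_r$. -/

import Mathlib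

noncomputable section

namespace TateSeries

/-- The ring of integers `R = {a ∈ K : |a| ≤ 1}` of a nonarchimedean normed field `K`. -/
abbrev RingOfIntegers (K : Type*) [NormedField K] [IsUltrametricDist K] : Type _ :=
  (NormedField.valuation (K := K)).valuationSubring

/-- The algebra `R⟨z_i : i ∈ σ⟩` of power series over `R = RingOfIntegers K` whose coefficients
tend to `0`, as a subring of the ring of all power series. -/
abbrev RestrictedSeries (K : Type*) [NormedField K] [IsUltrametricDist K] (σ : Type*) : Type _ :=
  MvPowerSeries.IsRestricted.subring (R := RingOfIntegers K) (fun _ : σ => (1 : ℝ))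

variable {K : Type*} [NormedField K] [IsUltrametricDist K] {σ : Type*}

/-- The coefficient of the monomial `z ^ e` in `f`. -/
def coeff (e : σ →₀ ℕ) (f : RestrictedSeries K σ) : RingOfIntegers K :=
  MvPowerSeries.coeff e (f : MvPowerSeries σ (RingOfIntegers K))

/-- The term `a * z ^ e`. -/
def term (e : σ →₀ ℕ) (a : RingOfIntegers K) : RestrictedSeries K σ :=
  ⟨MvPowerSeries.monomial e a, MvPowerSeries.isRestricted_monomial _ e a⟩

/-- The constant series with value `a`. -/
def const (σ : Type*) (a : RingOfIntegers K) : RestrictedSeries K σ :=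
  ⟨MvPowerSeries.C a, MvPowerSeries.isRestricted_C _ a⟩

theorem const_mul_const (a b : RingOfIntegers K) :
    const σ (a * b) = const σ a * const σ b :=
  Subtype.ext (map_mul (MvPowerSeries.C (σ := σ)) a b)

theorem const_one : const σ (1 : RingOfIntegers K) = 1 :=
  Subtype.ext (map_one (MvPowerSeries.C (σ := σ)))

/-- The saturation `J^ec = {f : a f ∈ J for some a ∈ R, a ≠ 0}` of an ideal `J`. -/
def saturation (J : Ideal (RestrictedSeries K σ)) : Ideal (RestrictedSeries K σ) where
  carrier := {f | ∃ a : RingOfIntegers K, a ≠ 0 ∧ const σ a * f ∈ J}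
  zero_mem' := ⟨1, one_ne_zero, by simp⟩
  add_mem' := by
    rintro f g ⟨a, ha, hf⟩ ⟨b, hb, hg⟩
    refine ⟨a * b, mul_ne_zero ha hb, ?_⟩
    have h : const σ (a * b) * (f + g) =
        const σ b * (const σ a * f) + const σ a * (const σ b * g) := by
      rw [const_mul_const]; ring
    rw [h]
    exact J.add_mem (J.mul_mem_left _ hf) (J.mul_mem_left _ hg)
  smul_mem' := by
    rintro c f ⟨a, ha, hf⟩
    refine ⟨a, ha, ?_⟩
    have h : const σ a * (c • f) = c * (const σ a * f) := by
      rw [smul_eq_mul]; ring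
    rw [h]
    exact J.mul_mem_left _ hf

/-- The order on terms attached to a monomial order `m`: `a z^d < b z^e` if `|a| < |b|`, or if
`|a| = |b|` and `z^d` is smaller than `z^e` for `m`. -/
def TermLT (m : MonomialOrder σ) (d : σ →₀ ℕ) (a : RingOfIntegers K)
    (e : σ →₀ ℕ) (b : RingOfIntegers K) : Prop :=
  ‖a‖ < ‖b‖ ∨ (‖a‖ = ‖b‖ ∧ m.toSyn d < m.toSyn e)

/-- The (nonzero) term of `f` with exponent `e` is the largest term of `f`. -/
def IsLeadingExponent (m : MonomialOrder σ) (f : RestrictedSeries K σ) (e : σ →₀ ℕ) : Prop :=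
  coeff e f ≠ 0 ∧ ∀ d, d ≠ e → coeff d f ≠ 0 → TermLT m d (coeff d f) e (coeff e f)

/-- Every nonzero series has exactly one leading exponent. -/
theorem existsUnique_isLeadingExponent (m : MonomialOrder σ) {f : RestrictedSeries K σ}
    (hf : f ≠ 0) : ∃! e, IsLeadingExponent m f e := by
  classical
  obtain ⟨e₀, he₀⟩ : ∃ e, coeff e f ≠ 0 := by
    by_contra! h
    exact hf (Subtype.ext (MvPowerSeries.ext h))
  have hpos : 0 < ‖coeff e₀ f‖ := norm_pos_iff.mpr he₀
  have hfin : {d | ‖coeff e₀ f‖ ≤ ‖coeff d f‖}.Finite := by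
    have h := f.2
    change Filter.Tendsto _ _ _ at h
    have h2 := h.eventually (gt_mem_nhds hpos)
    rw [Filter.eventually_cofinite] at h2
    refine h2.subset fun d hd => ?_
    have hd' : ‖coeff e₀ f‖ ≤ ‖coeff d f‖ := hd
    simpa [Finsupp.prod, coeff] using hd'
  obtain ⟨e, he, hmax⟩ := hfin.toFinset.exists_max_image
    (fun d => toLex (‖coeff d f‖, m.toSyn d)) ⟨e₀, by simp⟩
  have he' : ‖coeff e₀ f‖ ≤ ‖coeff e f‖ := by simpa using he
  refine ⟨e, ⟨norm_pos_iff.mp (hpos.trans_le he'), fun d hd _ => ?_⟩, ?_⟩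
  · by_cases hlt : ‖coeff e₀ f‖ ≤ ‖coeff d f‖
    · have := hmax d (by simpa using hlt)
      rcases (Prod.Lex.toLex_le_toLex).mp this with h | ⟨h, h'⟩
      · exact Or.inl h
      · exact Or.inr ⟨h, lt_of_le_of_ne h' fun h => hd (m.toSyn.injective h)⟩
    · exact Or.inl ((not_le.mp hlt).trans_le he')
  · rintro d ⟨hd0, hd⟩
    by_contra hne
    have h1 := hd e (Ne.symm hne) (norm_pos_iff.mp (hpos.trans_le he'))
    have hd1 : ‖coeff e f‖ ≤ ‖coeff d f‖ := h1.elim le_of_lt fun h => h.1.le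
    have := hmax d (by simpa using he'.trans hd1)
    rcases (Prod.Lex.toLex_le_toLex).mp this with h | ⟨h, h'⟩
    · exact absurd hd1 (not_le.mpr h)
    · rcases h1 with h1 | ⟨_, h1⟩
      · exact absurd h (ne_of_gt h1)
      · exact absurd h' (not_le.mpr h1)

open Classical in
/-- The leading term of `f`; it is `0` for `f = 0`. -/
def leadingTerm (m : MonomialOrder σ) (f : RestrictedSeries K σ) : RestrictedSeries K σ :=
  if h : ∃ e, IsLeadingExponent m f e then term h.choose (coeff h.choose f) else 0

/-- `t` is one of the (nonzero) terms of `f`. -/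
def IsTermOf (t f : RestrictedSeries K σ) : Prop :=
  ∃ e, coeff e f ≠ 0 ∧ t = term e (coeff e f)

/-- `G` is a Gröbner basis of `J`: a finite subset of `J` such that the leading term of each
nonzero element of `J` is a multiple of the leading term of an element of `G`. -/
def IsGroebnerBasis (m : MonomialOrder σ) (J : Ideal (RestrictedSeries K σ))
    (G : Set (RestrictedSeries K σ)) : Prop :=
  G.Finite ∧ G ⊆ J ∧ ∀ f ∈ J, f ≠ 0 → ∃ g ∈ G, leadingTerm m g ∣ leadingTerm m f

/-- A Gröbner basis `G` is reduced if each `g ∈ G` is monic, no term of `g` is a multiple of the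
leading term of another element of `G`, and no term of `g` minus its leading term is a multiple
of that leading term. -/
def IsReducedGroebnerBasis (m : MonomialOrder σ) (J : Ideal (RestrictedSeries K σ))
    (G : Set (RestrictedSeries K σ)) : Prop :=
  IsGroebnerBasis m J G ∧ ∀ g ∈ G,
    (∃ e, leadingTerm m g = term e 1) ∧
    (∀ h ∈ G, h ≠ g → ∀ t, IsTermOf t g → ¬ leadingTerm m h ∣ t) ∧
    (∀ t, IsTermOf t (g - leadingTerm m g) → ¬ leadingTerm m g ∣ t)

/-- The coefficientwise reduction of `f` modulo an ideal `a` of `R`. -/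
def reduce (a : Ideal (RingOfIntegers K)) (f : RestrictedSeries K σ) :
    MvPowerSeries σ (RingOfIntegers K ⧸ a) :=
  MvPowerSeries.map (Ideal.Quotient.mk a) (f : MvPowerSeries σ (RingOfIntegers K))

end TateSeries

/-- The variable `z_i` does not occur in the series `f`. -/
def MvPowerSeries.NotInvolves {σ A : Type*} [CommRing A] (f : MvPowerSeries σ A) (i : σ) : Prop :=
  ∀ e : σ →₀ ℕ, MvPowerSeries.coeff e f ≠ 0 → e i = 0

end

/-! Let L be the set of leading exponents of J, an upper set. A leading coefficient has maximal
norm, so saturation makes every e in L the leading exponent of a monic element of J; by Dickson's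
lemma L has finitely many minimal elements. Polynomial division modulo π, iterated π-adically,
brings any series modulo J to one with no exponent in L (`exists_normalForm`). A nonzero element of
J has an exponent in L, so this normal form is unique. The differences of z^e and its normal form,
for e minimal in L, are the only reduced Gröbner basis; they generate J, whence (b) ⇒ (a).

For (a) ⇒ (b), put c = π^M and split f = ∑ z^b f_b with b supported on the y's and f_b free of them.
The map f ↦ f_b is linear over series in the x's, so if J has generators free of the y's modulo c,
every f_b with f in J is congruent modulo c to an element of J (`exists_fiber_eq_add_const_mul`).
Let g in the basis have leading exponent e and a coefficient at d not divisible by c, and let b be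
the y-part of d. Then g_b is nonzero modulo c, so its leading exponent a lies in L, and a + b is an
exponent of g in L. Hence a + b = e, and minimality of e forces b = 0. The monomial order need not
eliminate the y's. -/

noncomputable section

namespace TateSeries

open Filter Topology

/-! ### Norms, coefficients and leading terms. -/

section Basic

variable {K : Type*} [NormedField K] [IsUltrametricDist K] {σ : Type*}

theorem norm_le_one (a : RingOfIntegers K) : ‖a‖ ≤ 1 := by
  have h := (Valuation.mem_valuationSubring_iff _ _).mp a.2
  exact_mod_cast h

theorem dvd_iff_norm_le {a b : RingOfIntegers K} : a ∣ b ↔ ‖b‖ ≤ ‖a‖ := by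
  constructor
  · rintro ⟨c, rfl⟩
    rw [norm_mul]
    exact mul_le_of_le_one_right (norm_nonneg a) (norm_le_one c)
  · intro h
    rcases eq_or_ne a 0 with rfl | ha
    · rw [norm_zero] at h
      rw [norm_le_zero_iff.mp h]
    · have ha' : (a : K) ≠ 0 := fun h => ha (Subtype.ext h)
      have hmem : (b / a : K) ∈ (NormedField.valuation (K := K)).valuationSubring := by
        rw [Valuation.mem_valuationSubring_iff]
        have : ‖(b / a : K)‖ ≤ 1 := by
          rw [norm_div]
          exact div_le_one_of_le₀ h (norm_nonneg _)
        exact_mod_cast this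
      exact ⟨⟨_, hmem⟩, Subtype.ext (mul_div_cancel₀ (b : K) ha').symm⟩

theorem norm_eq_of_norm_sub_lt {a b : RingOfIntegers K} (h : ‖a - b‖ < ‖b‖) : ‖a‖ = ‖b‖ := by
  have h1 := IsUltrametricDist.norm_add_eq_max_of_norm_ne_norm h.ne
  rwa [sub_add_cancel, max_eq_right h.le] at h1

/-- The restricted series with given coefficients. -/
def ofCoeff (c : (σ →₀ ℕ) → RingOfIntegers K) (hc : Tendsto (fun e => ‖c e‖) cofinite (𝓝 0)) :
    RestrictedSeries K σ :=
  ⟨fun e => c e, by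
    change Tendsto _ _ _
    simp only [one_pow, Finsupp.prod, Finset.prod_const_one, mul_one]
    exact hc⟩

@[simp] theorem coeff_ofCoeff (c : (σ →₀ ℕ) → RingOfIntegers K) (hc) (e : σ →₀ ℕ) :
    coeff e (ofCoeff c hc) = c e := rfl

theorem tendsto_norm_coeff (f : RestrictedSeries K σ) :
    Tendsto (fun e => ‖coeff e f‖) cofinite (𝓝 0) := by
  have h := f.2
  change Tendsto _ _ _ at h
  simpa [Finsupp.prod, coeff] using h

theorem ext_coeff {f g : RestrictedSeries K σ} (h : ∀ e, coeff e f = coeff e g) : f = g :=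
  Subtype.ext (MvPowerSeries.ext h)

@[simp] theorem coeff_zero (e : σ →₀ ℕ) : coeff e (0 : RestrictedSeries K σ) = 0 := rfl

@[simp] theorem coeff_add (e : σ →₀ ℕ) (f g : RestrictedSeries K σ) :
    coeff e (f + g) = coeff e f + coeff e g := rfl

@[simp] theorem coeff_sub (e : σ →₀ ℕ) (f g : RestrictedSeries K σ) :
    coeff e (f - g) = coeff e f - coeff e g := rfl

@[simp] theorem coeff_const_mul (e : σ →₀ ℕ) (a : RingOfIntegers K) (f : RestrictedSeries K σ) :
    coeff e (const σ a * f) = a * coeff e f :=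
  MvPowerSeries.coeff_C_mul e (f : MvPowerSeries σ (RingOfIntegers K)) a

open Classical in
theorem coeff_term (d e : σ →₀ ℕ) (a : RingOfIntegers K) :
    coeff d (term e a) = if d = e then a else 0 :=
  MvPowerSeries.coeff_monomial d e a

@[simp] theorem coeff_term_self (e : σ →₀ ℕ) (a : RingOfIntegers K) :
    coeff e (term e a) = a := by simp [coeff_term]

theorem coeff_term_of_ne {d e : σ →₀ ℕ} (h : d ≠ e) (a : RingOfIntegers K) :
    coeff d (term e a) = 0 := by simp [coeff_term, h]

open Classical in
theorem coeff_term_mul (d e : σ →₀ ℕ) (a : RingOfIntegers K) (f : RestrictedSeries K σ) :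
    coeff d (term e a * f) = if e ≤ d then a * coeff (d - e) f else 0 := by
  refine (MvPowerSeries.coeff_monomial_mul d e (f : MvPowerSeries σ (RingOfIntegers K)) a).trans ?_
  rfl

open Classical in
theorem coeff_mul (d : σ →₀ ℕ) (f g : RestrictedSeries K σ) :
    coeff d (f * g) = ∑ p ∈ Finset.HasAntidiagonal.antidiagonal d, coeff p.1 f * coeff p.2 g :=
  MvPowerSeries.coeff_mul d _ _

theorem ne_zero_of_coeff_ne_zero {f : RestrictedSeries K σ} {e : σ →₀ ℕ} (h : coeff e f ≠ 0) :
    f ≠ 0 := by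
  rintro rfl
  exact h rfl

/-- A series all of whose coefficients are multiples of `c` is a multiple of `c`. -/
theorem exists_eq_const_mul {f : RestrictedSeries K σ} {c : RingOfIntegers K} (hc : c ≠ 0)
    (h : ∀ e, ‖coeff e f‖ ≤ ‖c‖) : ∃ g, f = const σ c * g := by
  choose b hb using fun e => dvd_iff_norm_le.mpr (h e)
  have hc' : ‖c‖ ≠ 0 := norm_ne_zero_iff.mpr hc
  have h2 := (tendsto_norm_coeff f).mul_const (‖c‖⁻¹)
  rw [zero_mul] at h2
  have h3 : Tendsto (fun e => ‖b e‖) cofinite (𝓝 0) := h2.congr fun e => by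
    rw [hb e, norm_mul, mul_comm ‖c‖, mul_assoc, mul_inv_cancel₀ hc', mul_one]
  exact ⟨ofCoeff b h3, ext_coeff fun e => by simpa using hb e⟩

/-- A polynomial as a restricted series. -/
def ofPolynomial (K : Type*) [NormedField K] [IsUltrametricDist K] (σ : Type*) :
    MvPolynomial σ (RingOfIntegers K) →+* RestrictedSeries K σ :=
  (MvPolynomial.coeToMvPowerSeries.ringHom (σ := σ) (R := RingOfIntegers K)).codRestrict
    (MvPowerSeries.IsRestricted.subring (R := RingOfIntegers K) (fun _ : σ => (1 : ℝ))) fun p => by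
      refine tendsto_nhds_of_eventually_eq ?_
      rw [eventually_cofinite]
      refine p.support.finite_toSet.subset fun e he => ?_
      by_contra h
      simp_all

@[simp] theorem coeff_ofPolynomial (e : σ →₀ ℕ) (p : MvPolynomial σ (RingOfIntegers K)) :
    coeff e (ofPolynomial K σ p) = p.coeff e := rfl

theorem IsLeadingExponent.norm_coeff_le {m : MonomialOrder σ} {f : RestrictedSeries K σ}
    {e : σ →₀ ℕ} (h : IsLeadingExponent m f e) (d : σ →₀ ℕ) : ‖coeff d f‖ ≤ ‖coeff e f‖ := by
  by_cases hd : d = e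
  · rw [hd]
  by_cases h0 : coeff d f = 0
  · simp [h0]
  · exact (h.2 d hd h0).elim le_of_lt fun h => h.1.le

/-- Series that agree up to terms smaller than the leading one have the same leading exponent. -/
theorem IsLeadingExponent.of_norm_sub_lt {m : MonomialOrder σ} {f g : RestrictedSeries K σ}
    {e : σ →₀ ℕ} (h : IsLeadingExponent m f e)
    (hfg : ∀ d, ‖coeff d (g - f)‖ < ‖coeff e f‖) : IsLeadingExponent m g e := by
  have key : ∀ d, ‖coeff d g‖ ≤ ‖coeff e f‖ := fun d => by
    have h1 := IsUltrametricDist.norm_add_le_max (coeff d (g - f)) (coeff d f)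
    rw [coeff_sub, sub_add_cancel] at h1
    exact h1.trans (max_le (hfg d).le (h.norm_coeff_le d))
  -- The leading exponent is the largest one of maximal norm, so it suffices that both series attain
  -- this norm at the same exponents.
  have key2 : ∀ d, ‖coeff d g‖ = ‖coeff e f‖ ↔ ‖coeff d f‖ = ‖coeff e f‖ := fun d => by
    have h0 := hfg d
    rw [coeff_sub] at h0
    refine ⟨fun h1 => ?_, fun h1 => ?_⟩
    · rw [← h1] at h0 ⊢
      exact norm_eq_of_norm_sub_lt (norm_sub_rev (coeff d g) _ ▸ h0)
    · rw [← h1] at h0 ⊢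
      exact norm_eq_of_norm_sub_lt h0
  have he : ‖coeff e g‖ = ‖coeff e f‖ := (key2 e).mpr rfl
  refine ⟨norm_ne_zero_iff.mp (he ▸ norm_ne_zero_iff.mpr h.1), fun d hd _ => ?_⟩
  rcases (key d).lt_or_eq with h1 | h1
  · exact Or.inl (he ▸ h1)
  · have h2 := (key2 d).mp h1
    rcases h.2 d hd (norm_ne_zero_iff.mp (h2 ▸ norm_ne_zero_iff.mpr h.1)) with h3 | h3
    · exact absurd h2 h3.ne
    · exact Or.inr ⟨h1.trans he.symm, h3.2⟩

theorem leadingTerm_eq {m : MonomialOrder σ} {f : RestrictedSeries K σ} {e : σ →₀ ℕ}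
    (h : IsLeadingExponent m f e) : leadingTerm m f = term e (coeff e f) := by
  have hex : ∃ e, IsLeadingExponent m f e := ⟨e, h⟩
  have := (existsUnique_isLeadingExponent m (ne_zero_of_coeff_ne_zero h.1)).unique
    hex.choose_spec h
  rw [leadingTerm, dif_pos hex, this]

theorem IsLeadingExponent.of_leadingTerm_eq_term_one {m : MonomialOrder σ}
    {f : RestrictedSeries K σ} {e : σ →₀ ℕ} (h : leadingTerm m f = term e 1) :
    IsLeadingExponent m f e ∧ coeff e f = 1 := by
  have hf : ∃ d, IsLeadingExponent m f d := by
    by_contra hf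
    rw [leadingTerm, dif_neg hf] at h
    simpa using congrArg (coeff e) h
  obtain ⟨d, hd⟩ := hf
  rw [leadingTerm_eq hd] at h
  by_cases hde : e = d
  · subst hde
    exact ⟨hd, by simpa using congrArg (coeff e) h⟩
  · simpa [coeff_term_of_ne hde] using congrArg (coeff e) h

theorem term_one_dvd_term_iff {d e : σ →₀ ℕ} {a : RingOfIntegers K} (ha : a ≠ 0) :
    (term e 1 : RestrictedSeries K σ) ∣ term d a ↔ e ≤ d := by
  classical
  constructor
  · rintro ⟨f, hf⟩
    by_contra h
    have := congrArg (coeff d) hf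
    rw [coeff_term_mul, if_neg h, coeff_term_self] at this
    exact ha this
  · intro h
    refine ⟨term (d - e) a, ext_coeff fun c => ?_⟩
    rw [coeff_term_mul, coeff_term, coeff_term, one_mul]
    by_cases hc : e ≤ c
    · rw [if_pos hc]
      refine if_congr ⟨fun hcd => by rw [hcd], fun hcd => ?_⟩ rfl rfl
      rw [← tsub_add_cancel_of_le hc, hcd, tsub_add_cancel_of_le h]
    · rw [if_neg hc, if_neg]
      rintro rfl
      exact hc h

/-- A sequence with `Dₖ = π Dₖ₊₁` vanishes. -/
theorem eq_zero_of_forall_eq_const_mul {π : RingOfIntegers K} (hπ : ‖π‖ < 1)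
    {D : ℕ → RestrictedSeries K σ}
    (hD : ∀ k, D k = const σ π * D (k + 1)) : D 0 = 0 := by
  refine ext_coeff fun e => ?_
  have h : ∀ k, coeff e (D 0) = π ^ k * coeff e (D k) := fun k => by
    induction k with
    | zero => simp
    | succ k ih => rw [ih, hD k, coeff_const_mul, pow_succ, mul_assoc]
  rw [coeff_zero, ← norm_le_zero_iff]
  refine ge_of_tendsto' (tendsto_pow_atTop_nhds_zero_of_lt_one (norm_nonneg π) hπ) fun k => ?_
  rw [h k, norm_mul, norm_pow]
  exact mul_le_of_le_one_right (by positivity) (norm_le_one _)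

end Basic

/-! ### π-adically convergent sums. -/

section AdicSum

variable {K : Type*} [NormedField K] [IsUltrametricDist K] [CompleteSpace K] {σ : Type*}

instance : CompleteSpace (RingOfIntegers K) := by
  have h : IsClosed ((NormedField.valuation (K := K)).valuationSubring : Set K) := by
    have : ((NormedField.valuation (K := K)).valuationSubring : Set K) = {x | ‖x‖ ≤ 1} := by
      ext x
      rw [SetLike.mem_coe, Valuation.mem_valuationSubring_iff]
      exact_mod_cast Iff.rfl
    rw [this]
    exact isClosed_le continuous_norm continuous_const
  exact h.completeSpace_coe

variable {π : RingOfIntegers K}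

theorem summable_pow_mul (hπ : ‖π‖ < 1) (a : ℕ → RingOfIntegers K) : Summable fun i => π ^ i * a i := by
  refine Summable.of_norm_bounded (summable_geometric_of_lt_one (norm_nonneg π) hπ) fun i => ?_
  rw [norm_mul, norm_pow]
  exact mul_le_of_le_one_right (by positivity) (norm_le_one _)

theorem tsum_pow_mul (hπ : ‖π‖ < 1) (a : ℕ → RingOfIntegers K) :
    ∑' i, π ^ i * a i = a 0 + π * ∑' i, π ^ i * a (i + 1) := by
  rw [(summable_pow_mul hπ a).tsum_eq_zero_add, ← (summable_pow_mul hπ _).tsum_mul_left]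
  simp only [pow_zero, one_mul, pow_succ', mul_assoc]

/-- Modulo π^N only the first N series contribute, and each has coefficients tending to 0. This
makes the infinite sum a restricted series. -/
theorem eventually_norm_tsum_le (h0 : π ≠ 0) (hπ : ‖π‖ < 1) (p : ℕ → RestrictedSeries K σ) (N : ℕ) :
    ∀ᶠ e in cofinite, ‖∑' i, π ^ i * coeff e (p i)‖ ≤ ‖π‖ ^ N := by
  induction N generalizing p with
  | zero => exact Eventually.of_forall fun e => by simpa using norm_le_one _
  | succ N ih =>
    have hpos : 0 < ‖π‖ ^ (N + 1) := pow_pos (norm_pos_iff.mpr h0) _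
    filter_upwards [ih fun i => p (i + 1), (tendsto_norm_coeff (p 0)).eventually (gt_mem_nhds hpos)]
      with e h1 h2
    rw [tsum_pow_mul hπ]
    refine (IsUltrametricDist.norm_add_le_max _ _).trans (max_le h2.le ?_)
    rw [norm_mul, pow_succ']
    exact mul_le_mul_of_nonneg_left h1 (norm_nonneg π)

/-- The series `∑ πⁱ pᵢ`. -/
def adicSum (h0 : π ≠ 0) (hπ : ‖π‖ < 1) (p : ℕ → RestrictedSeries K σ) : RestrictedSeries K σ :=
  ofCoeff (fun e => ∑' i, π ^ i * coeff e (p i)) <| by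
    rw [NormedAddGroup.tendsto_nhds_zero]
    intro ε hε
    obtain ⟨N, hN⟩ := exists_pow_lt_of_lt_one hε hπ
    filter_upwards [eventually_norm_tsum_le h0 hπ p N] with e he
    rw [norm_norm]
    exact he.trans_lt hN

theorem coeff_adicSum (h0 : π ≠ 0) (hπ : ‖π‖ < 1) (p : ℕ → RestrictedSeries K σ) (e : σ →₀ ℕ) :
    coeff e (adicSum h0 hπ p) = ∑' i, π ^ i * coeff e (p i) := rfl

/-- With `eq_zero_of_forall_eq_const_mul`, this recursion proves identities between infinite sums
without interchanging sum and product. -/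
theorem adicSum_succ (h0 : π ≠ 0) (hπ : ‖π‖ < 1) (p : ℕ → RestrictedSeries K σ) :
    adicSum h0 hπ p = p 0 + const σ π * adicSum h0 hπ fun i => p (i + 1) :=
  ext_coeff fun e => by
    rw [coeff_add, coeff_const_mul, coeff_adicSum, coeff_adicSum, tsum_pow_mul hπ]

end AdicSum

/-! ### Division with remainder by monic series. -/

section Division

variable {K : Type*} [NormedField K] [IsUltrametricDist K] {σ : Type*}

/-- Every series is the polynomial of its unit terms plus a multiple of the uniformizer. -/
theorem exists_eq_ofPolynomial_add {π : RingOfIntegers K} (h0 : π ≠ 0)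
    (hπ : ∀ a : RingOfIntegers K, ‖a‖ < 1 → ‖a‖ ≤ ‖π‖) (f : RestrictedSeries K σ) :
    ∃ (p : MvPolynomial σ (RingOfIntegers K)) (g : RestrictedSeries K σ),
      f = ofPolynomial K σ p + const σ π * g ∧
        (∀ e, ‖coeff e f‖ = 1 → p.coeff e = coeff e f) ∧
        ∀ e, p.coeff e ≠ 0 → ‖coeff e f‖ = 1 ∧ p.coeff e = coeff e f := by
  classical
  have hfin : {e | ¬ ‖coeff e f‖ < 1}.Finite := by
    have := (tendsto_norm_coeff f).eventually (gt_mem_nhds one_pos)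
    rwa [eventually_cofinite] at this
  let p : MvPolynomial σ (RingOfIntegers K) :=
    ∑ e ∈ hfin.toFinset, MvPolynomial.monomial e (coeff e f)
  have hp : ∀ e, p.coeff e = if ‖coeff e f‖ < 1 then 0 else coeff e f := fun e => by
    rw [MvPolynomial.coeff_sum]
    simp only [MvPolynomial.coeff_monomial, Finset.sum_ite_eq', Set.Finite.mem_toFinset,
      Set.mem_ofPred_eq]
    by_cases h : ‖coeff e f‖ < 1
    · rw [if_pos h, if_neg (not_not.mpr h)]
    · rw [if_neg h, if_pos h]
  obtain ⟨g, hg⟩ := exists_eq_const_mul (f := f - ofPolynomial K σ p) h0 fun e => by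
    rw [coeff_sub, coeff_ofPolynomial, hp]
    split_ifs with h
    · rw [sub_zero]
      exact hπ _ h
    · simp
  refine ⟨p, g, by rw [← hg, add_sub_cancel], fun e he => by simp [hp, he], fun e he => ?_⟩
  rw [hp] at he ⊢
  split_ifs at he ⊢ with h
  · exact absurd rfl he
  · exact ⟨le_antisymm (norm_le_one _) (not_lt.mp h), rfl⟩

/-- One step of the division of a series by monic series. -/
theorem exists_division_step {π : RingOfIntegers K} (h0 : π ≠ 0)
    (hπ : ∀ a : RingOfIntegers K, ‖a‖ < 1 → ‖a‖ ≤ ‖π‖) (m : MonomialOrder σ)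
    {ι : Type*} [Fintype ι] {b : ι → RestrictedSeries K σ} {e : ι → σ →₀ ℕ}
    (hb : ∀ i, IsLeadingExponent m (b i) (e i)) (hb1 : ∀ i, coeff (e i) (b i) = 1)
    (f : RestrictedSeries K σ) :
    ∃ (q : ι → RestrictedSeries K σ) (r g : RestrictedSeries K σ),
      f = ∑ i, q i * b i + r + const σ π * g ∧ ∀ d, coeff d r ≠ 0 → ∀ i, ¬ e i ≤ d := by
  classical
  choose p t hpt hp1 hp using fun i => exists_eq_ofPolynomial_add h0 hπ (b i)
  have hpe : ∀ i, (p i).coeff (e i) = 1 := fun i => by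
    rw [hp1 i _ (by rw [hb1, norm_one]), hb1]
  -- All nonzero coefficients of `p i` have norm 1, so its terms are compared by the monomial order
  -- alone.
  have hdeg : ∀ i, m.degree (p i) = e i := fun i => by
    apply m.toSyn.injective
    refine le_antisymm (m.degree_le_iff.mpr fun d hd => ?_) (m.le_degree ?_)
    · by_cases hde : d = e i
      · rw [hde]
      · rw [MvPolynomial.mem_support_iff] at hd
        obtain ⟨h1, h2⟩ := hp i d hd
        rcases (hb i).2 d hde (h2 ▸ hd) with h | h
        · rw [h1, hb1, norm_one] at h
          exact absurd h (lt_irrefl 1)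
        · exact h.2.le
    · rw [MvPolynomial.mem_support_iff, hpe]
      exact one_ne_zero
  obtain ⟨p₀, t₀, hf, -, -⟩ := exists_eq_ofPolynomial_add h0 hπ f
  obtain ⟨q, r, hqr, -, hr⟩ := m.div (b := p) (fun i => by
    rw [MonomialOrder.leadingCoeff, hdeg, hpe]
    exact isUnit_one) p₀
  -- Replacing `p i` by `b i = p i + π * t i` in the polynomial division costs `π * ∑ q i * t i`,
  -- which goes into the new error.
  refine ⟨fun i => ofPolynomial K σ (q i), ofPolynomial K σ r,
    t₀ - ∑ i, ofPolynomial K σ (q i) * t i, ?_, fun d hd i => ?_⟩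
  · rw [Finsupp.linearCombination_apply, Finsupp.sum_fintype q (fun i a => a • p i) fun i =>
      zero_smul _ _] at hqr
    have h1 : ∀ i, ofPolynomial K σ (q i) * b i = ofPolynomial K σ (q i) * ofPolynomial K σ (p i) +
        const σ π * (ofPolynomial K σ (q i) * t i) := fun i => by
      nth_rewrite 1 [hpt i]
      ring
    simp only [h1]
    rw [hf, hqr, map_add, map_sum, Finset.sum_add_distrib, mul_sub, Finset.mul_sum]
    simp only [smul_eq_mul, map_mul]
    ring
  · rw [← hdeg]
    exact hr d (MvPolynomial.mem_support_iff.mpr hd) i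

/-- Division of a series by monic series. -/
theorem exists_division [CompleteSpace K] {π : RingOfIntegers K} (h0 : π ≠ 0) (h1 : ‖π‖ < 1)
    (hπ : ∀ a : RingOfIntegers K, ‖a‖ < 1 → ‖a‖ ≤ ‖π‖) (m : MonomialOrder σ)
    {ι : Type*} [Fintype ι] {b : ι → RestrictedSeries K σ} {e : ι → σ →₀ ℕ}
    (hb : ∀ i, IsLeadingExponent m (b i) (e i)) (hb1 : ∀ i, coeff (e i) (b i) = 1)
    (f : RestrictedSeries K σ) :
    ∃ (q : ι → RestrictedSeries K σ) (r : RestrictedSeries K σ),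
      f = ∑ i, q i * b i + r ∧ ∀ d, coeff d r ≠ 0 → ∀ i, ¬ e i ≤ d := by
  choose Q R F hF hR using exists_division_step h0 hπ m hb hb1
  let s : ℕ → RestrictedSeries K σ := fun k => F^[k] f
  have hs : ∀ k, s (k + 1) = F (s k) := fun k => Function.iterate_succ_apply' F k f
  refine ⟨fun i => adicSum h0 h1 fun k => Q (s k) i, adicSum h0 h1 fun k => R (s k), ?_,
    fun d hd i hid => hd ?_⟩
  -- The discrepancy between the k-th error `s k` and its expansion is π times the next discrepancy,
  -- hence vanishes.
  · have := eq_zero_of_forall_eq_const_mul h1 (D := fun k => s k -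
      (∑ i, adicSum h0 h1 (fun j => Q (s (k + j)) i) * b i +
        adicSum h0 h1 fun j => R (s (k + j)))) fun k => by
      have h2 : ∀ i, adicSum h0 h1 (fun j => Q (s (k + j)) i) * b i = Q (s k) i * b i +
          const σ π * (adicSum h0 h1 (fun j => Q (s (k + 1 + j)) i) * b i) := fun i => by
        rw [adicSum_succ, add_mul, mul_assoc]
        simp only [add_zero, add_assoc, add_comm 1]
      have h3 : adicSum h0 h1 (fun j => R (s (k + j))) = R (s k) +
          const σ π * adicSum h0 h1 (fun j => R (s (k + 1 + j))) := by
        rw [adicSum_succ]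
        simp only [add_zero, add_assoc, add_comm 1]
      simp only [h2]
      rw [h3, Finset.sum_add_distrib, ← Finset.mul_sum, hs]
      nth_rewrite 1 [hF (s k)]
      ring
    simp only [zero_add, sub_eq_zero] at this
    exact this
  · rw [coeff_adicSum]
    have : ∀ k, coeff d (R (s k)) = 0 := fun k => by
      by_contra h
      exact hR (s k) d h i hid
    simp [this]

end Division

/-! ### Existence, uniqueness and generation for the reduced basis. -/

section Basis

variable {K : Type*} [NormedField K] [IsUltrametricDist K] {σ : Type*}

/-- The leading exponents of the nonzero elements of an ideal. -/
def leadingExponents (m : MonomialOrder σ) (J : Ideal (RestrictedSeries K σ)) : Set (σ →₀ ℕ) :=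
  {e | ∃ f ∈ J, IsLeadingExponent m f e}

variable {m : MonomialOrder σ} {J : Ideal (RestrictedSeries K σ)}

/-- The leading coefficient divides all coefficients, and saturation keeps the quotient in J. -/
theorem exists_monic_of_mem_leadingExponents (hJ : J = saturation J) {e : σ →₀ ℕ}
    (he : e ∈ leadingExponents m J) : ∃ f ∈ J, IsLeadingExponent m f e ∧ coeff e f = 1 := by
  obtain ⟨f, hfJ, hf⟩ := he
  obtain ⟨g, hfg⟩ := exists_eq_const_mul hf.1 hf.norm_coeff_le
  have hg : g ∈ J := by
    rw [hJ]
    exact ⟨_, hf.1, hfg ▸ hfJ⟩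
  have hcoeff : ∀ d, coeff d f = coeff e f * coeff d g := fun d => by
    nth_rewrite 1 [hfg]
    rw [coeff_const_mul]
  have hge : coeff e g = 1 := (mul_eq_left₀ hf.1).mp (hcoeff e).symm
  have hpos := norm_pos_iff.mpr hf.1
  refine ⟨g, hg, ⟨hge ▸ one_ne_zero, fun d hd hd0 => ?_⟩, hge⟩
  have h := hf.2 d hd (by rw [hcoeff d]; exact mul_ne_zero hf.1 hd0)
  rw [TermLT, hcoeff d, norm_mul] at h
  rw [TermLT, hge, norm_one]
  refine h.imp (fun h => ?_) fun h => ⟨?_, h.2⟩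
  · exact (mul_lt_iff_lt_one_right hpos).mp h
  · exact (mul_eq_left₀ hpos.ne').mp h.1

theorem isUpperSet_leadingExponents : IsUpperSet (leadingExponents m J) := by
  classical
  rintro d e hde ⟨f, hfJ, hf⟩
  refine ⟨term (e - d) 1 * f, J.mul_mem_left _ hfJ, ?_⟩
  have he : coeff e (term (e - d) 1 * f) = coeff d f := by
    rw [coeff_term_mul, if_pos tsub_le_self, one_mul, tsub_tsub_cancel_of_le hde]
  refine ⟨he ▸ hf.1, fun c hc hc0 => ?_⟩
  rw [he]
  rw [coeff_term_mul] at hc0 ⊢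
  split_ifs at hc0 ⊢ with h
  · rw [one_mul] at hc0 ⊢
    have hne : c - (e - d) ≠ d := by
      rintro h1
      apply hc
      rw [← tsub_add_cancel_of_le h, h1, add_tsub_cancel_of_le hde]
    refine (hf.2 _ hne hc0).imp_right fun h1 => ⟨h1.1, ?_⟩
    have h2 : m.toSyn (c - (e - d)) + m.toSyn (e - d) < m.toSyn d + m.toSyn (e - d) := by
      gcongr
      exact h1.2
    rwa [← map_add, ← map_add, tsub_add_cancel_of_le h, add_tsub_cancel_of_le hde] at h2
  · exact absurd rfl hc0

/-- An element of `J` without terms in the leading exponents of `J` is zero. -/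
theorem eq_zero_of_forall_notMem {f : RestrictedSeries K σ} (hf : f ∈ J)
    (h : ∀ d, coeff d f ≠ 0 → d ∉ leadingExponents m J) : f = 0 := by
  by_contra h0
  obtain ⟨e, he, -⟩ := existsUnique_isLeadingExponent m h0
  exact h e he.1 ⟨f, hf, he⟩

/-- The series `z^e + ∑ a_d z^d` in `J`, where `e` is a minimal leading exponent of `J` and the
exponents `d` are not leading exponents of `J`. -/
def reducedBasis (m : MonomialOrder σ) (J : Ideal (RestrictedSeries K σ)) :
    Set (RestrictedSeries K σ) :=
  {g | g ∈ J ∧ ∃ e, Minimal (· ∈ leadingExponents m J) e ∧ coeff e g = 1 ∧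
    ∀ d, d ≠ e → coeff d g ≠ 0 → d ∉ leadingExponents m J}

theorem isLeadingExponent_of_forall_notMem {g : RestrictedSeries K σ} (hg : g ∈ J) {e : σ →₀ ℕ}
    (he : coeff e g ≠ 0) (h : ∀ d, d ≠ e → coeff d g ≠ 0 → d ∉ leadingExponents m J) :
    IsLeadingExponent m g e := by
  obtain ⟨c, hc, -⟩ := existsUnique_isLeadingExponent m (ne_zero_of_coeff_ne_zero he)
  by_cases hce : c = e
  · exact hce ▸ hc
  · exact absurd ⟨g, hg, hc⟩ (h c hce hc.1)

/-- The coefficients at `e` cancel, so the difference is an element of J with no exponent in L. -/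
theorem eq_of_isLeadingExponent {f g : RestrictedSeries K σ} {e : σ →₀ ℕ}
    (hf : f ∈ J) (hg : g ∈ J) (hf1 : coeff e f = 1) (hg1 : coeff e g = 1)
    (hf2 : ∀ d, d ≠ e → coeff d f ≠ 0 → d ∉ leadingExponents m J)
    (hg2 : ∀ d, d ≠ e → coeff d g ≠ 0 → d ∉ leadingExponents m J) : f = g := by
  rw [← sub_eq_zero]
  refine eq_zero_of_forall_notMem (m := m) (J.sub_mem hf hg) fun d hd => ?_
  rw [coeff_sub] at hd
  by_cases hde : d = e
  · rw [hde, hf1, hg1, sub_self] at hd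
    exact absurd rfl hd
  · by_cases h : coeff d f = 0
    · exact hg2 d hde fun h' => hd (by rw [h, h', sub_zero])
    · exact hf2 d hde h

theorem IsReducedGroebnerBasis.exists_isLeadingExponent {G : Set (RestrictedSeries K σ)}
    (hG : IsReducedGroebnerBasis m J G) {g : RestrictedSeries K σ} (hg : g ∈ G) :
    ∃ e, IsLeadingExponent m g e ∧ leadingTerm m g = term e 1 ∧ coeff e g = 1 := by
  obtain ⟨e, he⟩ := (hG.2 g hg).1
  exact ⟨e, (IsLeadingExponent.of_leadingTerm_eq_term_one he).1, he,
    (IsLeadingExponent.of_leadingTerm_eq_term_one he).2⟩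

theorem IsReducedGroebnerBasis.exists_le {G : Set (RestrictedSeries K σ)}
    (hG : IsReducedGroebnerBasis m J G) {d : σ →₀ ℕ} (hd : d ∈ leadingExponents m J) :
    ∃ g ∈ G, ∃ e, leadingTerm m g = term e 1 ∧ e ≤ d := by
  obtain ⟨f, hf, hfd⟩ := hd
  obtain ⟨g, hg, hgf⟩ := hG.1.2.2 f hf (ne_zero_of_coeff_ne_zero hfd.1)
  obtain ⟨e, -, he, -⟩ := hG.exists_isLeadingExponent hg
  rw [he, leadingTerm_eq hfd, term_one_dvd_term_iff hfd.1] at hgf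
  exact ⟨g, hg, e, he, hgf⟩

theorem IsReducedGroebnerBasis.mem_reducedBasis {G : Set (RestrictedSeries K σ)}
    (hG : IsReducedGroebnerBasis m J G) {g : RestrictedSeries K σ} (hg : g ∈ G) {e : σ →₀ ℕ}
    (he : leadingTerm m g = term e 1) :
    Minimal (· ∈ leadingExponents m J) e ∧ coeff e g = 1 ∧
      ∀ d, d ≠ e → coeff d g ≠ 0 → d ∉ leadingExponents m J := by
  obtain ⟨hge, hge1⟩ := IsLeadingExponent.of_leadingTerm_eq_term_one he
  -- Some leading term from G divides this term of `g`; reducedness leaves only that of `g` itself.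
  have key : ∀ d ∈ leadingExponents m J, coeff d g ≠ 0 → leadingTerm m g ∣ term d (coeff d g) := by
    intro d hd hd0
    obtain ⟨h, hh, c, hc, hcd⟩ := hG.exists_le hd
    by_cases hhg : h = g
    · rw [← hhg, hc, term_one_dvd_term_iff (hhg ▸ hd0)]
      exact hcd
    · refine absurd ?_ ((hG.2 g hg).2.1 h hh hhg _ ⟨d, hd0, rfl⟩)
      rw [hc, term_one_dvd_term_iff hd0]
      exact hcd
  refine ⟨⟨⟨g, hG.1.2.1 hg, hge⟩, fun d hd hde => ?_⟩, hge1, fun d hde hd0 hd => ?_⟩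
  · obtain ⟨h, hh, c, hc, hcd⟩ := hG.exists_le hd
    by_cases hhg : h = g
    · have : c = e := by
        rw [hhg] at hc
        exact (existsUnique_isLeadingExponent m (ne_zero_of_coeff_ne_zero hge.1)).unique
          (IsLeadingExponent.of_leadingTerm_eq_term_one hc).1 hge
      exact this ▸ hcd
    · refine absurd ?_ ((hG.2 g hg).2.1 h hh hhg _ ⟨e, hge.1, rfl⟩)
      rw [hc, term_one_dvd_term_iff hge.1]
      exact hcd.trans hde
  · have hsub : coeff d (g - leadingTerm m g) = coeff d g := by
      rw [he, coeff_sub, coeff_term_of_ne hde, sub_zero]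
    exact (hG.2 g hg).2.2 _ ⟨d, hsub ▸ hd0, rfl⟩ (hsub ▸ key d hd hd0)

/-- The right-hand side does not depend on G, so this is uniqueness. -/
theorem IsReducedGroebnerBasis.eq_reducedBasis {G : Set (RestrictedSeries K σ)}
    (hG : IsReducedGroebnerBasis m J G) : G = reducedBasis m J := by
  ext g
  constructor
  · intro hg
    obtain ⟨e, -, he, -⟩ := hG.exists_isLeadingExponent hg
    exact ⟨hG.1.2.1 hg, e, hG.mem_reducedBasis hg he⟩
  · rintro ⟨hgJ, e, hemin, hg1, hg2⟩
    obtain ⟨h, hh, c, hc, hce⟩ := hG.exists_le hemin.prop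
    obtain ⟨hcmin, hh1, hh2⟩ := hG.mem_reducedBasis hh hc
    obtain rfl : c = e := le_antisymm hce (hemin.2 hcmin.prop hce)
    rwa [eq_of_isLeadingExponent hgJ (hG.1.2.1 hh) hg1 hh1 hg2 hh2]

variable [CompleteSpace K] [Finite σ] {π : RingOfIntegers K}

/-- Division by a saturated ideal. -/
theorem exists_normalForm (h0 : π ≠ 0) (h1 : ‖π‖ < 1)
    (hπ : ∀ a : RingOfIntegers K, ‖a‖ < 1 → ‖a‖ ≤ ‖π‖) (hJ : J = saturation J)
    (f : RestrictedSeries K σ) :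
    ∃ r, f - r ∈ J ∧ (∀ d, coeff d r ≠ 0 → d ∉ leadingExponents m J) := by
  have hfin : {e | Minimal (· ∈ leadingExponents m J) e}.Finite :=
    WellQuasiOrderedLE.finite_of_isAntichain (setOfPred_minimal_antichain _)
  have := hfin.fintype
  choose b hbJ hb hb1 using fun e : {e | Minimal (· ∈ leadingExponents m J) e} =>
    exists_monic_of_mem_leadingExponents hJ e.2.prop
  obtain ⟨q, r, hf, hr⟩ := exists_division h0 h1 hπ m hb hb1 f
  refine ⟨r, ?_, fun d hd hdL => ?_⟩
  · rw [hf, add_sub_cancel_right]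
    exact J.sum_mem fun i _ => J.mul_mem_left _ (hbJ i)
  · obtain ⟨e, hed, he⟩ := (Set.isPWO_of_wellQuasiOrderedLE
      (leadingExponents m J)).exists_le_minimal hdL
    exact hr d hd ⟨e, he⟩ hed

/-- The witness is z^e minus its normal form, which has no term at `e` because `e` is in L. -/
theorem exists_mem_reducedBasis (h0 : π ≠ 0) (h1 : ‖π‖ < 1)
    (hπ : ∀ a : RingOfIntegers K, ‖a‖ < 1 → ‖a‖ ≤ ‖π‖) (hJ : J = saturation J) {e : σ →₀ ℕ}
    (he : Minimal (· ∈ leadingExponents m J) e) :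
    ∃ g ∈ reducedBasis m J, leadingTerm m g = term e 1 := by
  obtain ⟨r, hrJ, hr⟩ := exists_normalForm (m := m) h0 h1 hπ hJ (term e 1)
  have he1 : coeff e (term e 1 - r) = 1 := by
    by_cases h : coeff e r = 0
    · rw [coeff_sub, coeff_term_self, h, sub_zero]
    · exact absurd he.prop (hr e h)
  have h2 : ∀ d, d ≠ e → coeff d (term e 1 - r) ≠ 0 → d ∉ leadingExponents m J := by
    intro d hd hd0
    rw [coeff_sub, coeff_term_of_ne hd, zero_sub, neg_ne_zero] at hd0
    exact hr d hd0
  refine ⟨term e 1 - r, ⟨hrJ, e, he, he1, h2⟩, ?_⟩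
  rw [leadingTerm_eq (isLeadingExponent_of_forall_notMem hrJ (by rw [he1]; exact one_ne_zero) h2),
    he1]

theorem isReducedGroebnerBasis_reducedBasis (h0 : π ≠ 0) (h1 : ‖π‖ < 1)
    (hπ : ∀ a : RingOfIntegers K, ‖a‖ < 1 → ‖a‖ ≤ ‖π‖) (hJ : J = saturation J) :
    IsReducedGroebnerBasis m J (reducedBasis m J) := by
  have hlt : ∀ g ∈ J, ∀ e, coeff e g = 1 →
      (∀ d, d ≠ e → coeff d g ≠ 0 → d ∉ leadingExponents m J) → leadingTerm m g = term e 1 :=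
    fun g hg e he h2 => by
      rw [leadingTerm_eq (isLeadingExponent_of_forall_notMem hg (he ▸ one_ne_zero) h2), he]
  refine ⟨⟨?_, fun g hg => hg.1, fun f hf hf0 => ?_⟩, ?_⟩
  · have hfin : {e | Minimal (· ∈ leadingExponents m J) e}.Finite :=
      WellQuasiOrderedLE.finite_of_isAntichain (setOfPred_minimal_antichain _)
    choose b hb hbe using fun e : {e | Minimal (· ∈ leadingExponents m J) e} =>
      exists_mem_reducedBasis h0 h1 hπ hJ e.2
    have := hfin.to_subtype
    refine (Set.finite_range b).subset ?_
    rintro g ⟨hgJ, e, he, hg1, hg2⟩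
    obtain ⟨hbJ, c, hc, hb1, hb2⟩ := hb ⟨e, he⟩
    obtain rfl : e = c := (existsUnique_isLeadingExponent m
      (ne_zero_of_coeff_ne_zero (hb1 ▸ one_ne_zero : coeff c (b ⟨e, he⟩) ≠ 0))).unique
      (IsLeadingExponent.of_leadingTerm_eq_term_one (hbe ⟨e, he⟩)).1
      (IsLeadingExponent.of_leadingTerm_eq_term_one (hlt _ hbJ c hb1 hb2)).1
    exact ⟨⟨e, he⟩, eq_of_isLeadingExponent hbJ hgJ hb1 hg1 hb2 hg2⟩
  · obtain ⟨d, hd, -⟩ := existsUnique_isLeadingExponent m hf0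
    obtain ⟨e, hed, he⟩ := (Set.isPWO_of_wellQuasiOrderedLE
      (leadingExponents m J)).exists_le_minimal ⟨f, hf, hd⟩
    obtain ⟨g, hg, hge⟩ := exists_mem_reducedBasis h0 h1 hπ hJ he
    refine ⟨g, hg, ?_⟩
    rw [hge, leadingTerm_eq hd, term_one_dvd_term_iff hd.1]
    exact hed
  · rintro g ⟨hgJ, e, he, hg1, hg2⟩
    have hge := hlt g hgJ e hg1 hg2
    refine ⟨⟨e, hge⟩, ?_, ?_⟩
    · rintro h ⟨hhJ, c, hc, hh1, hh2⟩ hne t ⟨d, hd0, rfl⟩ hdvd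
      rw [hlt h hhJ c hh1 hh2, term_one_dvd_term_iff hd0] at hdvd
      have hdL := isUpperSet_leadingExponents hdvd hc.prop
      obtain rfl : d = e := by
        by_contra hde
        exact hg2 d hde hd0 hdL
      obtain rfl : c = d := le_antisymm hdvd (he.2 hc.prop hdvd)
      exact hne (eq_of_isLeadingExponent hhJ hgJ hh1 hg1 hh2 hg2)
    · rintro t ⟨d, hd0, rfl⟩ hdvd
      rw [hge] at hd0 hdvd
      rw [term_one_dvd_term_iff hd0] at hdvd
      by_cases hde : d = e
      · rw [hde, coeff_sub, hg1, coeff_term_self, sub_self] at hd0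
        exact hd0 rfl
      · rw [coeff_sub, coeff_term_of_ne hde, sub_zero] at hd0
        exact hg2 d hde hd0 (isUpperSet_leadingExponents hdvd he.prop)

/-- The reduced basis generates the ideal. -/
theorem span_reducedBasis (h0 : π ≠ 0) (h1 : ‖π‖ < 1)
    (hπ : ∀ a : RingOfIntegers K, ‖a‖ < 1 → ‖a‖ ≤ ‖π‖) (hJ : J = saturation J) :
    Ideal.span (reducedBasis m J) = J := by
  refine le_antisymm (Ideal.span_le.mpr fun g hg => hg.1) fun f hf => ?_
  have hfin : {e | Minimal (· ∈ leadingExponents m J) e}.Finite :=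
    WellQuasiOrderedLE.finite_of_isAntichain (setOfPred_minimal_antichain _)
  have := hfin.fintype
  choose b hb hbe using fun e : {e | Minimal (· ∈ leadingExponents m J) e} =>
    exists_mem_reducedBasis h0 h1 hπ hJ e.2
  obtain ⟨q, r, hfr, hr⟩ := exists_division h0 h1 hπ m
    (fun e => (IsLeadingExponent.of_leadingTerm_eq_term_one (hbe e)).1)
    (fun e => (IsLeadingExponent.of_leadingTerm_eq_term_one (hbe e)).2) f
  have hr0 : r = 0 := by
    refine eq_zero_of_forall_notMem (m := m) (J := J) ?_ fun d hd hdL => ?_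
    · rw [← sub_eq_of_eq_add' hfr]
      exact J.sub_mem hf (J.sum_mem fun i _ => J.mul_mem_left _ (hb i).1)
    · obtain ⟨e, hed, he⟩ := (Set.isPWO_of_wellQuasiOrderedLE
      (leadingExponents m J)).exists_le_minimal hdL
      exact hr d hd ⟨e, he⟩ hed
  rw [hfr, hr0, add_zero]
  exact Ideal.sum_mem _ fun i _ => Ideal.mul_mem_left _ _ (Ideal.subset_span (hb i))

end Basis

/-! ### Splitting a series along the monomials in Y. -/

section Fiber

variable {K : Type*} [NormedField K] [IsUltrametricDist K] {σ : Type*}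

open Classical in
/-- For a set `Y` of variables and an exponent `b`, the series whose product with `z ^ b` consists
of the terms of `f` with exponent in `b + c`, where `c` does not involve `Y`. -/
def fiber (Y : Set σ) (b : σ →₀ ℕ) (f : RestrictedSeries K σ) : RestrictedSeries K σ :=
  ofCoeff (fun e => if ∀ i ∈ Y, e i = 0 then coeff (e + b) f else 0) <| by
    refine squeeze_zero (fun _ => norm_nonneg _) (fun e => ?_)
      ((tendsto_norm_coeff f).comp (add_left_injective b).tendsto_cofinite)
    dsimp only [Function.comp]
    split_ifs
    · exact le_rfl
    · rw [norm_zero]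
      exact norm_nonneg _

variable {Y : Set σ} {b : σ →₀ ℕ}

theorem coeff_fiber {e : σ →₀ ℕ} (he : ∀ i ∈ Y, e i = 0) (f : RestrictedSeries K σ) :
    coeff e (fiber Y b f) = coeff (e + b) f := if_pos he

theorem coeff_fiber_of_not {e : σ →₀ ℕ} (he : ¬ ∀ i ∈ Y, e i = 0) (f : RestrictedSeries K σ) :
    coeff e (fiber Y b f) = 0 := if_neg he

theorem fiber_zero : fiber Y b (0 : RestrictedSeries K σ) = 0 :=
  ext_coeff fun e => by
    by_cases he : ∀ i ∈ Y, e i = 0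
    · simp [coeff_fiber he]
    · simp [coeff_fiber_of_not he]

theorem fiber_add (f g : RestrictedSeries K σ) :
    fiber Y b (f + g) = fiber Y b f + fiber Y b g :=
  ext_coeff fun e => by
    by_cases he : ∀ i ∈ Y, e i = 0
    · simp [coeff_fiber he]
    · simp [coeff_fiber_of_not he]

theorem fiber_const_mul (a : RingOfIntegers K) (f : RestrictedSeries K σ) :
    fiber Y b (const σ a * f) = const σ a * fiber Y b f :=
  ext_coeff fun e => by
    by_cases he : ∀ i ∈ Y, e i = 0
    · simp [coeff_fiber he]
    · simp [coeff_fiber_of_not he]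

/-- Taking fibers is linear over the series that do not involve `Y`. -/
theorem fiber_mul {s : RestrictedSeries K σ} (hs : ∀ e, coeff e s ≠ 0 → ∀ i ∈ Y, e i = 0)
    (hb : ∀ i ∉ Y, b i = 0) (f : RestrictedSeries K σ) :
    fiber Y b (f * s) = fiber Y b f * s := by
  classical
  -- Shifting by z^b lets both products be compared over the same antidiagonal.
  have key : ∀ e, coeff (e + b) (term b 1 * fiber Y b f * s) = coeff e (fiber Y b f * s) :=
    fun e => by
      rw [mul_assoc, coeff_term_mul, if_pos le_add_self, one_mul, add_tsub_cancel_right]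
  refine ext_coeff fun e => ?_
  rw [← key]
  by_cases he : ∀ i ∈ Y, e i = 0
  · rw [coeff_fiber he, coeff_mul, coeff_mul]
    refine Finset.sum_congr rfl fun p hp => ?_
    by_cases h : coeff p.2 s = 0
    · rw [h, mul_zero, mul_zero]
    · have hp2 := hs _ h
      have hpe : p.1 + p.2 = e + b := by simpa using hp
      -- As `s` is free of Y, the whole Y-part `b` of the exponent falls on the factor from `f`.
      have hpY : ∀ i ∈ Y, p.1 i = b i := fun i hi => by
        have := DFunLike.congr_fun hpe i
        simpa [hp2 i hi, he i hi] using this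
      have hle : b ≤ p.1 := fun i => by
        by_cases hi : i ∈ Y
        · exact (hpY i hi).ge
        · simp [hb i hi]
      rw [coeff_term_mul, if_pos hle, one_mul, coeff_fiber (fun i hi => by simp [hpY i hi]),
        tsub_add_cancel_of_le hle]
  · rw [coeff_fiber_of_not he, key, coeff_mul]
    refine (Finset.sum_eq_zero fun p hp => ?_).symm
    by_cases h : coeff p.2 s = 0
    · rw [h, mul_zero]
    · rw [coeff_fiber_of_not, zero_mul]
      intro h1
      refine he fun i hi => ?_
      have hpe : p.1 + p.2 = e := by simpa using hp
      simp [← hpe, h1 i hi, hs _ h i hi]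

/-- A series that does not involve `Y` modulo `c` is the sum of a series that does not involve `Y`
and a multiple of `c`. -/
theorem exists_eq_add_const_mul {c : RingOfIntegers K} (hc : c ≠ 0) {f : RestrictedSeries K σ}
    (hf : ∀ e, ‖c‖ < ‖coeff e f‖ → ∀ i ∈ Y, e i = 0) :
    ∃ s t, f = s + const σ c * t ∧ ∀ e, coeff e s ≠ 0 → ∀ i ∈ Y, e i = 0 := by
  obtain ⟨t, ht⟩ := exists_eq_const_mul (f := f - fiber Y 0 f) hc fun e => by
    rw [coeff_sub]
    by_cases he : ∀ i ∈ Y, e i = 0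
    · simp [coeff_fiber he]
    · rw [coeff_fiber_of_not he, sub_zero]
      by_contra h
      exact he (hf e (not_le.mp h))
  refine ⟨fiber Y 0 f, t, by rw [← ht, add_sub_cancel], fun e he => ?_⟩
  by_contra h
  exact he (coeff_fiber_of_not h f)

/-- If an ideal is generated by series which do not involve `Y` modulo `c`, then the fibers of its
elements are in the ideal modulo `c`. -/
theorem exists_fiber_eq_add_const_mul {c : RingOfIntegers K} (hc : c ≠ 0)
    {S : Set (RestrictedSeries K σ)}
    (hS : ∀ f ∈ S, ∀ e, ‖c‖ < ‖coeff e f‖ → ∀ i ∈ Y, e i = 0) (hb : ∀ i ∉ Y, b i = 0)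
    {f : RestrictedSeries K σ} (hf : f ∈ Ideal.span S) :
    ∃ h ∈ Ideal.span S, ∃ t, h = fiber Y b f + const σ c * t := by
  induction hf using Submodule.closure_induction with
  | zero => exact ⟨0, Ideal.zero_mem _, 0, by rw [fiber_zero, mul_zero, add_zero]⟩
  | add f g _ _ hf hg =>
    obtain ⟨h₁, hh₁, t₁, rfl⟩ := hf
    obtain ⟨h₂, hh₂, t₂, rfl⟩ := hg
    exact ⟨_, Ideal.add_mem _ hh₁ hh₂, t₁ + t₂, by rw [fiber_add]; ring⟩
  | smul_mem a f hf =>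
    -- Here `f` is a generator: modulo `c` it equals `s`, so the fiber of `a * f` is congruent to
    -- `fiber Y b a * f`, which lies in the ideal.
    obtain ⟨s, t, hst, hs⟩ := exists_eq_add_const_mul hc (hS f hf)
    refine ⟨fiber Y b a * f, Ideal.mul_mem_left _ _ (Ideal.subset_span hf),
      fiber Y b a * t - fiber Y b (a * t), ?_⟩
    have h1 : fiber Y b (a • f) = fiber Y b a * s + const σ c * fiber Y b (a * t) := by
      rw [hst, smul_eq_mul, mul_add, mul_left_comm, fiber_add, fiber_mul hs hb, fiber_const_mul]
    rw [h1, hst]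
    ring

end Fiber

/-! ### From generators to the reduced basis, modulo c. -/

section Main

variable {K : Type*} [NormedField K] [IsUltrametricDist K] {σ : Type*}

theorem notInvolves_reduce_iff {c : RingOfIntegers K} {f : RestrictedSeries K σ} {i : σ} :
    (reduce (Ideal.span {c}) f).NotInvolves i ↔ ∀ e, ‖c‖ < ‖coeff e f‖ → e i = 0 := by
  refine forall_congr' fun e => imp_congr_left ?_
  rw [← not_le, ← dvd_iff_norm_le, ← Ideal.mem_span_singleton, not_iff_not,
    ← Ideal.Quotient.eq_zero_iff_mem]
  rfl

/-- If an ideal is generated by series which do not involve `Y` modulo `c`, then the elements of its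
reduced basis do not involve `Y` modulo `c`. -/
theorem eq_zero_of_mem_reducedBasis {m : MonomialOrder σ} {J : Ideal (RestrictedSeries K σ)}
    {Y : Set σ} {c : RingOfIntegers K} (hc : c ≠ 0)
    {S : Set (RestrictedSeries K σ)} (hSJ : Ideal.span S = J)
    (hS : ∀ f ∈ S, ∀ e, ‖c‖ < ‖coeff e f‖ → ∀ i ∈ Y, e i = 0)
    {g : RestrictedSeries K σ} (hg : g ∈ reducedBasis m J) {d : σ →₀ ℕ} (hd : ‖c‖ < ‖coeff d g‖)
    {i : σ} (hi : i ∈ Y) : d i = 0 := by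
  classical
  obtain ⟨hgJ, e, he, hg1, hg2⟩ := hg
  set b := d.filter (· ∈ Y) with hb
  set a₀ := d.filter (· ∉ Y) with ha₀
  have hab : a₀ + b = d := by
    rw [add_comm, hb, ha₀]
    exact Finsupp.filter_add_filter_not d _
  have ha₀Y : ∀ j ∈ Y, a₀ j = 0 := fun j hj => Finsupp.filter_apply_neg _ _ (not_not.mpr hj)
  have hbY : ∀ j ∉ Y, b j = 0 := fun j hj => Finsupp.filter_apply_neg _ _ hj
  have hfib : coeff a₀ (fiber Y b g) = coeff d g := by rw [coeff_fiber ha₀Y, hab]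
  have hne : fiber Y b g ≠ 0 := ne_zero_of_coeff_ne_zero (e := a₀) <| by
    rw [hfib]
    exact norm_pos_iff.mp ((norm_nonneg c).trans_lt hd)
  obtain ⟨a, ha, -⟩ := existsUnique_isLeadingExponent m hne
  obtain ⟨h, hh, t, rfl⟩ := exists_fiber_eq_add_const_mul hc hS hbY (hSJ ▸ hgJ)
  -- The leading coefficient of the fiber has norm at least that of the coefficient of `g` at `d`,
  -- hence above `‖c‖`; a change by a multiple of `c` keeps the leading exponent.
  have haL : a ∈ leadingExponents m J := by
    refine ⟨_, hSJ ▸ hh, ha.of_norm_sub_lt fun k => ?_⟩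
    rw [add_sub_cancel_left, coeff_const_mul, norm_mul]
    exact (mul_le_of_le_one_right (norm_nonneg c) (norm_le_one _)).trans_lt
      ((hfib ▸ hd).trans_le (ha.norm_coeff_le a₀))
  have haY : ∀ j ∈ Y, a j = 0 := by
    by_contra h
    exact ha.1 (coeff_fiber_of_not h g)
  have hab0 : coeff (a + b) g ≠ 0 := coeff_fiber haY g ▸ ha.1
  have habe : a + b = e := by
    by_contra h
    exact hg2 _ h hab0 (isUpperSet_leadingExponents le_self_add haL)
  have hb0 : b = 0 := by
    have h1 : e ≤ a := he.2 haL (habe ▸ le_self_add)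
    rw [← habe] at h1
    exact le_antisymm (by simpa using h1) zero_le
  rw [← hab, Finsupp.add_apply, ha₀Y i hi, hb0, Finsupp.zero_apply, add_zero]

end Main

/-! ### The norm gap below 1. -/

section Uniformizer

variable {K : Type*} [NontriviallyNormedField K] [IsUltrametricDist K]

theorem norm_lt_one_iff_mem_maximalIdeal {a : RingOfIntegers K} :
    ‖a‖ < 1 ↔ a ∈ IsLocalRing.maximalIdeal (RingOfIntegers K) := by
  rw [IsLocalRing.mem_maximalIdeal, mem_nonunits_iff, isUnit_iff_dvd_one, dvd_iff_norm_le,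
    norm_one, not_le]

/-- Discreteness enters here: every nonunit is a multiple of π. Nontriviality of the norm supplies a
nonzero nonunit, so π is not 0. -/
theorem uniformizer_properties {π : RingOfIntegers K}
    (hπ : IsLocalRing.maximalIdeal (RingOfIntegers K) = Ideal.span {π}) :
    π ≠ 0 ∧ ‖π‖ < 1 ∧ ∀ a : RingOfIntegers K, ‖a‖ < 1 → ‖a‖ ≤ ‖π‖ := by
  have h : ∀ a : RingOfIntegers K, ‖a‖ < 1 → ‖a‖ ≤ ‖π‖ := fun a ha => by
    rw [norm_lt_one_iff_mem_maximalIdeal, hπ, Ideal.mem_span_singleton] at ha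
    exact dvd_iff_norm_le.mp ha
  refine ⟨?_, ?_, h⟩
  · rintro rfl
    obtain ⟨x, hx0, hx1⟩ := NormedField.exists_norm_lt_one K
    have hmem : x ∈ (NormedField.valuation (K := K)).valuationSubring := by
      rw [Valuation.mem_valuationSubring_iff]
      exact_mod_cast hx1.le
    have : ‖x‖ ≤ ‖(0 : RingOfIntegers K)‖ := h ⟨x, hmem⟩ hx1
    rw [norm_zero] at this
    exact absurd this (not_le.mpr hx0)
  · rw [norm_lt_one_iff_mem_maximalIdeal, hπ]
    exact Ideal.mem_span_singleton_self π

end Uniformizer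

end TateSeries
end

theorem mainTheorem10 {K : Type*} [NontriviallyNormedField K] [IsUltrametricDist K]
    [CompleteSpace K] (π : TateSeries.RingOfIntegers K)
    (hπ : IsLocalRing.maximalIdeal (TateSeries.RingOfIntegers K) = Ideal.span {π})
    (n r : ℕ) (m : MonomialOrder (Fin n ⊕ Fin r))
    (J : Ideal (TateSeries.RestrictedSeries K (Fin n ⊕ Fin r)))
    (hJ : J = TateSeries.saturation J) (M : ℕ) (hM : 0 < M) :
    (∃! G, TateSeries.IsReducedGroebnerBasis m J G) ∧
    ∀ G, TateSeries.IsReducedGroebnerBasis m J G →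
      ((∃ S : Set (TateSeries.RestrictedSeries K (Fin n ⊕ Fin r)), Ideal.span S = J ∧
          ∀ f ∈ S, ∀ j : Fin r,
            (TateSeries.reduce (Ideal.span {π ^ M}) f).NotInvolves (Sum.inr j)) ↔
        ∀ g ∈ G, ∀ j : Fin r,
          (TateSeries.reduce (Ideal.span {π ^ M}) g).NotInvolves (Sum.inr j)) := by
  obtain ⟨h0, h1, h2⟩ := TateSeries.uniformizer_properties hπ
  refine ⟨⟨_, TateSeries.isReducedGroebnerBasis_reducedBasis h0 h1 h2 hJ,
    fun G hG => hG.eq_reducedBasis⟩, fun G hG => ?_⟩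
  obtain rfl := hG.eq_reducedBasis
  simp only [TateSeries.notInvolves_reduce_iff]
  constructor
  · rintro ⟨S, hSJ, hS⟩ g hg j d hd
    refine TateSeries.eq_zero_of_mem_reducedBasis (Y := Set.range Sum.inr) (pow_ne_zero M h0) hSJ
      ?_ hg hd ⟨j, rfl⟩
    rintro f hf e he _ ⟨k, rfl⟩
    exact hS f hf k e he
  · exact fun h => ⟨_, TateSeries.span_reducedBasis h0 h1 h2 hJ, h⟩
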